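/- Let $D=\{z\in\mathbb C:|z|<1\}$. For $f:\mathbb R\to\mathbb R$ let $\|f\|=\sup_I\left|\int_I f\right|$ be the Alexiewicz norm, where $I$ ranges over the intervals $I\subset\mathbb R$ of length at most $2\pi$, the integrals are Henstock--Kurzweil integrals, and $\|f\|=\infty$ if $f$ is not Henstock--Kurzweil integrable over some such $I$. Let $\mathcal{HK}$ be the set of $2\pi$-periodic functions $f:\mathbb R\to\mathbb R$ with $\|f\|<\infty$. For $0\le r<1$ let $\Phi_r(\theta)=\dfrac{1-r^2}{2\pi(1-2r\cos\theta+r^2)}$ be the Poisson kernel, and for a function $u:D\to\mathbb R$ write $u_r(\theta)=u(re^{i\theta})$. Theorem. Let $f\in\mathcal{HK}$. Then for all $0\le r<1$ and $\theta\in\mathbb R$ the Poisson integral $$P[f](re^{i\theta})=\int_{-\pi}^{\pi}f(\phi)\,\Phi_r(\phi-\theta)\,d\phi$$ exists as a Henstock--Kurzweil integral (and depends only on the point $re^{i\theta}$), and the Dirichlet problem $$u\in C^2(D),\qquad \Delta u=0\ \text{ in } D,\qquad \|u_r-f\|\to 0\ \text{ as } r\to 1^-$$ has the unique solution $u=P[f]$;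 that is, $P[f]$ is a solution, and every $u:D\to\mathbb R$ which is a solution equals $P[f]$ on $D$. -/

import Mathlib

open scoped Topology ENNReal Laplacian

noncomputable section

namespace HKPoisson

/-- The segment from `a` to `b` (with `a < b`) as a one-dimensional box. -/
def segmentBox (a b : ℝ) (h : a < b) : BoxIntegral.Box (Fin 1) where
  lower := fun _ => a
  upper := fun _ => b
  lower_lt_upper := fun _ => h

/-- `f` is Henstock–Kurzweil integrable on `[a, b]`, `a < b`, with integral `y`. -/
def HasHKIntegral (f : ℝ → ℝ) (a b y : ℝ) : Prop :=
  ∃ h : a < b, BoxIntegral.HasIntegral (segmentBox a b h) BoxIntegral.IntegrationParams.Henstock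
    (fun x => f (x 0)) BoxIntegral.BoxAdditiveMap.volume y

/-- `f` is Henstock–Kurzweil integrable on `[a, b]`, `a < b`. -/
def HKIntegrable (f : ℝ → ℝ) (a b : ℝ) : Prop :=
  ∃ y, HasHKIntegral f a b y

/-- The Henstock–Kurzweil integral of `f` over `[a, b]`
(it is `0` by convention if `f` is not integrable or `b ≤ a`). -/
def hkIntegral (f : ℝ → ℝ) (a b : ℝ) : ℝ :=
  if h : a < b then
    BoxIntegral.integral (segmentBox a b h) BoxIntegral.IntegrationParams.Henstock
      (fun x => f (x 0)) BoxIntegral.BoxAdditiveMap.volume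
  else 0

open Classical in
/-- The Alexiewicz norm of `f`: the supremum of `|∫_I f|` over the intervals `I ⊆ ℝ` of length at
most `2π`. It takes values in `[0, ∞]`, and it is `∞` as soon as `f` fails to be
Henstock–Kurzweil integrable on one of these intervals. (The endpoints of `I` do not affect the
integral and degenerate intervals contribute `0`, so `I` ranges over `[a, b]` with `a < b`.) -/
def alexiewiczNorm (f : ℝ → ℝ) : ℝ≥0∞ :=
  ⨆ (a : ℝ) (b : ℝ) (_ : a < b) (_ : b - a ≤ 2 * Real.pi),
    if HKIntegrable f a b then ENNReal.ofReal |hkIntegral f a b| else ⊤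

/-- The space of `2π`-periodic functions with finite Alexiewicz norm. -/
def HK : Set (ℝ → ℝ) :=
  {f | Function.Periodic f (2 * Real.pi) ∧ alexiewiczNorm f < ⊤}

/-- The Poisson kernel `Φ_r(θ)` of the unit disc. -/
def poissonKernel (r θ : ℝ) : ℝ :=
  (1 - r ^ 2) / (2 * Real.pi * (1 - 2 * r * Real.cos θ + r ^ 2))

/-- The point `r e^{iθ}`. -/
def polar (r θ : ℝ) : ℂ :=
  (r : ℂ) * Complex.exp ((θ : ℂ) * Complex.I)

/-- The Poisson integral `P[f]`, as a function of `z = r e^{iθ}` with `r = |z|`, `θ = arg z`. -/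
def poissonIntegral (f : ℝ → ℝ) (z : ℂ) : ℝ :=
  hkIntegral (fun φ => f φ * poissonKernel ‖z‖ (φ - z.arg)) (-Real.pi) Real.pi

/-- `u` solves the Dirichlet problem in the open unit disc `D` with boundary data `f`, assumed in
the Alexiewicz norm. Only the values of `u` in `D` matter. -/
structure IsDirichletSolution (f : ℝ → ℝ) (u : ℂ → ℝ) : Prop where
  contDiffOn : ContDiffOn ℝ 2 u (Metric.ball 0 1)
  laplacian_eq_zero : ∀ z ∈ Metric.ball (0 : ℂ) 1, Δ u z = 0
  tendsto_boundary :
    Filter.Tendsto (fun r : ℝ => alexiewiczNorm (fun θ => u (polar r θ) - f θ)) (𝓝[<] 1) (𝓝 0)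

end HKPoisson

end

namespace HKPoisson

open BoxIntegral MeasureTheory Filter Set

theorem segmentBox_lower_upper (J : Box (Fin 1)) :
    segmentBox (J.lower 0) (J.upper 0) (J.lower_lt_upper 0) = J := by
  ext x
  simp [Box.mem_def, segmentBox]

theorem volume_apply_fin_one (J : Box (Fin 1)) (y : ℝ) :
    BoxAdditiveMap.volume J y = (J.upper 0 - J.lower 0) * y := by
  rw [BoxAdditiveMap.volume_apply]
  simp

/-- The increment of a function of one variable over a segment, as a box-additive map. -/
noncomputable def increment (G : ℝ → ℝ) : Fin 1 →ᵇᵃ ℝ :=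
  BoxAdditiveMap.ofMapSplitAdd (fun J => G (J.upper 0) - G (J.lower 0)) ⊤ (by
    intro J _ i x hx
    obtain rfl : i = 0 := Subsingleton.elim _ _
    rw [Box.splitLower_def hx, Box.splitUpper_def hx]
    change (G (Function.update J.upper 0 x 0) - G (J.lower 0)) +
      (G (J.upper 0) - G (Function.update J.lower 0 x 0)) = _
    rw [Function.update_self, Function.update_self]
    ring)

@[simp] theorem increment_apply (G : ℝ → ℝ) (J : Box (Fin 1)) :
    increment G J = G (J.upper 0) - G (J.lower 0) := rfl

theorem sum_increment {a b : ℝ} (hab : a < b) (G : ℝ → ℝ)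
    {π : TaggedPrepartition (segmentBox a b hab)}
    (hπ : π.IsPartition) : ∑ J ∈ π.boxes, (G (J.upper 0) - G (J.lower 0)) = G b - G a :=
  (increment G).sum_partition_boxes le_top hπ

theorem HasHKIntegral.lt {f : ℝ → ℝ} {a b y : ℝ} (h : HasHKIntegral f a b y) : a < b := h.1

theorem HasHKIntegral.unique {f : ℝ → ℝ} {a b y z : ℝ} (h : HasHKIntegral f a b y)
    (h' : HasHKIntegral f a b z) : y = z :=
  h.2.unique h'.2

theorem HasHKIntegral.hkIntegral_eq {f : ℝ → ℝ} {a b y : ℝ} (h : HasHKIntegral f a b y) :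
    hkIntegral f a b = y := by
  rw [hkIntegral, dif_pos h.1]
  exact h.2.integral_eq

theorem HKIntegrable.hasHKIntegral {f : ℝ → ℝ} {a b : ℝ} (h : HKIntegrable f a b) :
    HasHKIntegral f a b (hkIntegral f a b) := by
  obtain ⟨y, hy⟩ := h
  rwa [hy.hkIntegral_eq]

theorem HasHKIntegral.sub {f g : ℝ → ℝ} {a b y z : ℝ} (h : HasHKIntegral f a b y)
    (h' : HasHKIntegral g a b z) : HasHKIntegral (fun x => f x - g x) a b (y - z) :=
  ⟨h.1, h.2.sub h'.2⟩

theorem HasHKIntegral.congr {f g : ℝ → ℝ} {a b y : ℝ} (h : HasHKIntegral f a b y)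
    (hfg : ∀ x, f x = g x) : HasHKIntegral g a b y := by
  rwa [← funext hfg]

theorem HKIntegrable.mono {f : ℝ → ℝ} {a b u v : ℝ} (h : HKIntegrable f a b) (hau : a ≤ u)
    (huv : u < v) (hvb : v ≤ b) : HKIntegrable f u v := by
  obtain ⟨y, hab, hy⟩ := h
  obtain ⟨z, hz⟩ := hy.integrable.to_subbox (J := segmentBox u v huv)
    (Box.le_iff_bounds.2 ⟨fun _ => hau, fun _ => hvb⟩)
  exact ⟨z, huv, hz⟩

theorem hkIntegral_add_adjacent {f : ℝ → ℝ} {a b c : ℝ} (h : HKIntegrable f a b) (hac : a < c)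
    (hcb : c < b) : hkIntegral f a c + hkIntegral f c b = hkIntegral f a b := by
  obtain ⟨y, hab, hy⟩ := h
  have key := hy.integrable.toBoxAdditive.map_split_add le_rfl (0 : Fin 1) c
  have hc : c ∈ Ioo ((segmentBox a b hab).lower 0) ((segmentBox a b hab).upper 0) := ⟨hac, hcb⟩
  rw [Box.splitLower_def hc, Box.splitUpper_def hc] at key
  rw [hkIntegral, hkIntegral, hkIntegral, dif_pos hac, dif_pos hcb, dif_pos hab]
  refine Eq.trans ?_ key
  congr 1
  · simp only [Integrable.toBoxAdditive, BoxAdditiveMap.coe_mk, Option.elim']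
    congr 1
    rw [← segmentBox_lower_upper ⟨_, _, _⟩]
    simp [segmentBox]
  · simp only [Integrable.toBoxAdditive, BoxAdditiveMap.coe_mk, Option.elim']
    congr 1
    rw [← segmentBox_lower_upper ⟨_, _, _⟩]
    simp [segmentBox]

/-- `F` is an indefinite Henstock–Kurzweil integral of `f` on `[a, b]`. -/
def IsHKPrimitive (f F : ℝ → ℝ) (a b : ℝ) : Prop :=
  ∀ u v, a ≤ u → u < v → v ≤ b → HasHKIntegral f u v (F v - F u)

theorem HKIntegrable.isHKPrimitive {f : ℝ → ℝ} {a b : ℝ} (h : HKIntegrable f a b) :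
    IsHKPrimitive f (fun x => hkIntegral f a x) a b := by
  intro u v hau huv hvb
  have := (h.mono hau huv hvb).hasHKIntegral
  rcases hau.eq_or_lt with rfl | hau
  · have h0 : hkIntegral f a a = 0 := by simp [hkIntegral]
    simpa [h0] using this
  · simpa [← hkIntegral_add_adjacent (h.mono le_rfl (hau.trans huv) hvb) hau huv] using this

/-- The **Saks–Henstock lemma**. -/
theorem IsHKPrimitive.exists_gauge {f F : ℝ → ℝ} {a b : ℝ} (h : IsHKPrimitive f F a b)
    (hab : a < b) {ε : ℝ} (hε : 0 < ε) :
    ∃ r : (Fin 1 → ℝ) → Ioi (0 : ℝ), ∀ π : TaggedPrepartition (segmentBox a b hab),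
      π.IsHenstock → π.IsSubordinate r →
      ∑ J ∈ π.boxes, |(J.upper 0 - J.lower 0) * f (π.tag J 0) - (F (J.upper 0) - F (J.lower 0))|
        ≤ ε := by
  obtain ⟨_, hi⟩ := h a b le_rfl hab le_rfl
  have hi := hi.integrable
  refine ⟨hi.convergenceR (ε / 2) 0, fun π hH hS => ?_⟩
  have hmem : IntegrationParams.Henstock.MemBaseSet _ 0 (hi.convergenceR (ε / 2) 0) π :=
    ⟨hS, fun _ => hH, fun h => by simp [IntegrationParams.Henstock] at h,
      fun h => by simp [IntegrationParams.Henstock] at h⟩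
  set t : Box (Fin 1) → ℝ := fun J =>
    (J.upper 0 - J.lower 0) * f (π.tag J 0) - (F (J.upper 0) - F (J.lower 0)) with ht
  have key : ∀ p : Box (Fin 1) → Prop, |∑ J ∈ (π.filter p).boxes, t J| ≤ ε / 2 := by
    intro p
    have := hi.dist_integralSum_sum_integral_le_of_memBaseSet (half_pos hε) (hmem.filter p)
    rw [Real.dist_eq, integralSum, ← Finset.sum_sub_distrib] at this
    convert this using 3 with J hJ
    have hJπ : J ∈ π := ((π.mem_filter).1 hJ).1
    have hle := Box.le_iff_bounds.1 (π.le_of_mem hJπ)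
    have hint := h (J.lower 0) (J.upper 0) (hle.1 0) (J.lower_lt_upper 0) (hle.2 0)
    have e := hint.hkIntegral_eq
    rw [hkIntegral, dif_pos (J.lower_lt_upper 0), segmentBox_lower_upper] at e
    rw [volume_apply_fin_one, e]
    rfl
  classical
  have h1 := key (fun J => 0 ≤ t J)
  have h2 := key (fun J => ¬ 0 ≤ t J)
  have e1 : (π.filter (fun J => 0 ≤ t J)).boxes = π.boxes.filter (fun J => 0 ≤ t J) := by
    ext J; exact π.mem_filter.trans (by simp)
  have e2 : (π.filter (fun J => ¬ 0 ≤ t J)).boxes = π.boxes.filter (fun J => ¬ 0 ≤ t J) := by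
    ext J; exact π.mem_filter.trans (by simp)
  rw [e1] at h1
  rw [e2] at h2
  rw [← Finset.sum_filter_add_sum_filter_not π.boxes (fun J => 0 ≤ t J)]
  have s1 : ∑ J ∈ π.boxes.filter (fun J => 0 ≤ t J), |t J| =
      ∑ J ∈ π.boxes.filter (fun J => 0 ≤ t J), t J :=
    Finset.sum_congr rfl fun J hJ => abs_of_nonneg (Finset.mem_filter.1 hJ).2
  have s2 : ∑ J ∈ π.boxes.filter (fun J => ¬ 0 ≤ t J), |t J| =
      -∑ J ∈ π.boxes.filter (fun J => ¬ 0 ≤ t J), t J := by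
    rw [← Finset.sum_neg_distrib]
    exact Finset.sum_congr rfl fun J hJ =>
      abs_of_nonpos (not_le.1 (Finset.mem_filter.1 hJ).2).le
  change ∑ J ∈ π.boxes.filter (fun J => 0 ≤ t J), |t J| +
    ∑ J ∈ π.boxes.filter (fun J => ¬ 0 ≤ t J), |t J| ≤ ε
  rw [s1, s2]
  linarith [le_abs_self (∑ J ∈ π.boxes.filter (fun J => 0 ≤ t J), t J),
    neg_abs_le (∑ J ∈ π.boxes.filter (fun J => ¬ 0 ≤ t J), t J)]

theorem IsHKPrimitive.exists_gauge_segment {f F : ℝ → ℝ} {a b : ℝ} (h : IsHKPrimitive f F a b)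
    (hab : a < b) {ε : ℝ} (hε : 0 < ε) (ξ : ℝ) :
    ∃ δ > 0, ∀ u v, a ≤ u → u < v → v ≤ b → u ≤ ξ → ξ ≤ v → ξ - u ≤ δ → v - ξ ≤ δ →
      |(v - u) * f ξ - (F v - F u)| ≤ ε := by
  obtain ⟨r, hr⟩ := h.exists_gauge hab hε
  refine ⟨r (fun _ => ξ), (r _).2, fun u v hau huv hvb huξ hξv h1 h2 => ?_⟩
  have hle : segmentBox u v huv ≤ segmentBox a b hab :=
    Box.le_iff_bounds.2 ⟨fun _ => hau, fun _ => hvb⟩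
  have hξ : (fun _ => ξ) ∈ Box.Icc (segmentBox a b hab) :=
    ⟨fun _ => hau.trans huξ, fun _ => hξv.trans hvb⟩
  have := hr (TaggedPrepartition.single _ (segmentBox u v huv) hle (fun _ => ξ) hξ)
    ((TaggedPrepartition.isHenstock_single_iff hle hξ).2 ⟨fun _ => huξ, fun _ => hξv⟩)
    ((TaggedPrepartition.isSubordinate_single hle hξ).2 ?_)
  · simpa [TaggedPrepartition.single, Prepartition.single, segmentBox] using this
  · intro x hx
    have hx1 : u ≤ x 0 := hx.1 0
    have hx2 : x 0 ≤ v := hx.2 0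
    rw [Metric.mem_closedBall, dist_pi_le_iff (r _).2.le]
    intro i
    obtain rfl : i = 0 := Subsingleton.elim _ _
    rw [Real.dist_eq, abs_le]
    constructor <;> linarith

theorem IsHKPrimitive.continuousOn {f F : ℝ → ℝ} {a b : ℝ} (h : IsHKPrimitive f F a b)
    (hab : a < b) : ContinuousOn F (Icc a b) := by
  intro ξ hξ
  rw [Metric.continuousWithinAt_iff']
  intro ε hε
  obtain ⟨δ, hδ, H⟩ := h.exists_gauge_segment hab (half_pos hε) ξ
  have h1 : ∀ᶠ x in 𝓝[Icc a b] ξ, |(x - ξ) * f ξ| < ε / 2 := by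
    have : Tendsto (fun x => |(x - ξ) * f ξ|) (𝓝 ξ) (𝓝 0) := by
      have : Continuous (fun x => |(x - ξ) * f ξ|) := by fun_prop
      simpa using this.tendsto ξ
    exact (this.mono_left nhdsWithin_le_nhds).eventually_lt_const (half_pos hε)
  have h2 : ∀ᶠ x in 𝓝[Icc a b] ξ, |x - ξ| ≤ δ :=
    nhdsWithin_le_nhds (Metric.closedBall_mem_nhds ξ hδ)
  filter_upwards [h1, h2, self_mem_nhdsWithin] with x h1 h2 hx
  rw [Real.dist_eq]
  rw [abs_le] at h2
  rw [abs_lt] at h1 ⊢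
  rcases lt_trichotomy x ξ with hlt | rfl | hlt
  · have := abs_le.1 (H x ξ hx.1 hlt hξ.2 hlt.le le_rfl (by linarith) (by linarith))
    constructor <;> nlinarith
  · simp [hε]
  · have := abs_le.1 (H ξ x hξ.1 hlt hx.2 le_rfl hlt.le (by linarith) (by linarith))
    constructor <;> nlinarith

theorem IsHKPrimitive.hasHKIntegral_of_abs_sub_le {f F φ G : ℝ → ℝ} {a b C : ℝ}
    (h : IsHKPrimitive f F a b) (hab : a < b) (hC : 0 ≤ C)
    (H : ∀ ε > 0, ∃ δ : ℝ → ℝ, (∀ x, 0 < δ x) ∧ ∀ u ξ v, a ≤ u → u ≤ ξ → ξ ≤ v → v ≤ b → u < v →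
      ξ - u ≤ δ ξ → v - ξ ≤ δ ξ →
      |(v - u) * φ ξ - (G v - G u)| ≤ C * |(v - u) * f ξ - (F v - F u)| + ε * (v - u)) :
    HasHKIntegral φ a b (G b - G a) := by
  refine ⟨hab, HasIntegral.of_mul (C + (b - a)) fun ε hε => ?_⟩
  obtain ⟨r, hr⟩ := h.exists_gauge hab hε
  obtain ⟨δ, hδ0, hδ⟩ := H ε hε
  refine ⟨fun _ x => min (r x) ⟨δ (x 0), hδ0 _⟩, fun _ =>
    IntegrationParams.rCond_of_bRiemann_eq_false _ rfl, fun c π hπ hp => ?_⟩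
  have hH : π.IsHenstock := hπ.2 rfl
  have hS := hπ.1
  have hs := hr π hH (fun J hJ => (hS J hJ).trans
    (Metric.closedBall_subset_closedBall (Subtype.coe_le_coe.2 (min_le_left _ _))))
  rw [← sum_increment hab G hp, Real.dist_eq, integralSum, ← Finset.sum_sub_distrib]
  have hlen := sum_increment hab (fun x => x) hp
  calc _ ≤ ∑ J ∈ π.boxes, |(BoxAdditiveMap.volume J) (φ (π.tag J 0)) -
          (G (J.upper 0) - G (J.lower 0))| := Finset.abs_sum_le_sum_abs _ _
    _ ≤ ∑ J ∈ π.boxes, (C * |(J.upper 0 - J.lower 0) * f (π.tag J 0) -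
          (F (J.upper 0) - F (J.lower 0))| + ε * (J.upper 0 - J.lower 0)) := by
        refine Finset.sum_le_sum fun J hJ => ?_
        rw [volume_apply_fin_one]
        have hle := Box.le_iff_bounds.1 (π.le_of_mem hJ)
        have ht := hH J hJ
        have hsub := (hS J hJ).trans
          (Metric.closedBall_subset_closedBall (Subtype.coe_le_coe.2 (min_le_right _ _)))
        have h1 := hsub J.lower_mem_Icc
        have h2 := hsub J.upper_mem_Icc
        rw [Metric.mem_closedBall, dist_pi_le_iff (hδ0 _).le] at h1 h2
        have h1 := h1 0
        have h2 := h2 0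
        rw [Real.dist_eq, abs_le] at h1 h2
        exact hδ _ _ _ (hle.1 0) (ht.1 0) (ht.2 0) (hle.2 0) (J.lower_lt_upper 0)
          (by linarith [h1.1]) (by linarith [h2.2])
    _ ≤ C * ε + ε * (b - a) := by
        rw [Finset.sum_add_distrib, ← Finset.mul_sum, ← Finset.mul_sum, hlen]
        gcongr
    _ = (C + (b - a)) * ε := by ring

section Translation

variable {ι : Type*}

/-- The translate of a box by a vector. -/
def translateBox (t : ι → ℝ) (J : Box ι) : Box ι where
  lower := J.lower + t
  upper := J.upper + t
  lower_lt_upper i := by simp [J.lower_lt_upper i]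

theorem mem_translateBox {t x : ι → ℝ} {J : Box ι} : x ∈ translateBox t J ↔ x - t ∈ J := by
  simp only [Box.mem_def, translateBox, mem_Ioc, Pi.add_apply, Pi.sub_apply]
  exact forall_congr' fun i => and_congr lt_sub_iff_add_lt.symm sub_le_iff_le_add.symm

theorem mem_Icc_translateBox {t x : ι → ℝ} {J : Box ι} :
    x ∈ Box.Icc (translateBox t J) ↔ x - t ∈ Box.Icc J := by
  simp only [Box.Icc_def, translateBox, mem_Icc, le_sub_iff_add_le, sub_le_iff_le_add]

theorem translateBox_neg_translateBox (t : ι → ℝ) (J : Box ι) :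
    translateBox (-t) (translateBox t J) = J := by
  ext x
  simp [mem_translateBox]

theorem translateBox_injective (t : ι → ℝ) : Function.Injective (translateBox t) :=
  Function.LeftInverse.injective (translateBox_neg_translateBox t)

/-- The translate of a tagged prepartition by a vector. -/
def translateTagged (t : ι → ℝ) {I : Box ι} (π : TaggedPrepartition I) :
    TaggedPrepartition (translateBox t I) where
  boxes := π.boxes.map ⟨translateBox t, translateBox_injective t⟩
  le_of_mem' J hJ := by
    obtain ⟨J₀, hJ₀, rfl⟩ := Finset.mem_map.1 hJ
    exact fun x hx => mem_translateBox.2 (π.le_of_mem hJ₀ (mem_translateBox.1 hx))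
  pairwiseDisjoint := by
    intro J hJ J' hJ' hne
    obtain ⟨J₀, hJ₀, rfl⟩ := Finset.mem_map.1 hJ
    obtain ⟨J₁, hJ₁, rfl⟩ := Finset.mem_map.1 hJ'
    have hne' : J₀ ≠ J₁ := fun h => hne (by rw [h])
    have := Set.disjoint_left.1 (π.pairwiseDisjoint hJ₀ hJ₁ hne')
    exact Set.disjoint_left.2 fun x hx hx' => this (mem_translateBox.1 hx) (mem_translateBox.1 hx')
  tag J := π.tag (translateBox (-t) J) + t
  tag_mem_Icc J := mem_Icc_translateBox.2 (by simpa using π.tag_mem_Icc _)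

theorem mem_translateTagged {t : ι → ℝ} {I J : Box ι} {π : TaggedPrepartition I} :
    J ∈ translateTagged t π ↔ ∃ J' ∈ π, translateBox t J' = J :=
  Finset.mem_map

theorem tag_translateTagged (t : ι → ℝ) {I : Box ι} (π : TaggedPrepartition I) (J : Box ι) :
    (translateTagged t π).tag (translateBox t J) = π.tag J + t := by
  simp [translateTagged, translateBox_neg_translateBox]

theorem isPartition_translateTagged (t : ι → ℝ) {I : Box ι} {π : TaggedPrepartition I}
    (hπ : π.IsPartition) : (translateTagged t π).IsPartition := by
  intro x hx
  obtain ⟨J, hJ, hxJ⟩ := hπ _ (mem_translateBox.1 hx)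
  exact ⟨_, mem_translateTagged.2 ⟨J, hJ, rfl⟩, mem_translateBox.2 hxJ⟩

end Translation

theorem HasHKIntegral.comp_add_right {f : ℝ → ℝ} {a b y T : ℝ}
    (h : HasHKIntegral f (a + T) (b + T) y) : HasHKIntegral (fun x => f (x + T)) a b y := by
  obtain ⟨hab, hy⟩ := h
  have hab' : a < b := by linarith
  refine ⟨hab', hasIntegral_iff.2 fun ε hε => ?_⟩
  obtain ⟨r, -, hr⟩ := hasIntegral_iff.1 hy ε hε
  set t : Fin 1 → ℝ := fun _ => T with ht
  have hbox : translateBox t (segmentBox a b hab') = segmentBox (a + T) (b + T) hab := rfl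
  rw [← hbox] at hr
  refine ⟨fun c x => r c (x + t), fun _ =>
    IntegrationParams.rCond_of_bRiemann_eq_false _ rfl, fun c π hπ hp => ?_⟩
  have key := hr c (translateTagged t π) ⟨?_, fun _ => ?_,
    fun h => by simp [IntegrationParams.Henstock] at h,
    fun h => by simp [IntegrationParams.Henstock] at h⟩ (isPartition_translateTagged t hp)
  · convert key using 2
    rw [integralSum, integralSum]
    simp only [translateTagged, Finset.sum_map, Function.Embedding.coeFn_mk,
      translateBox_neg_translateBox, volume_apply_fin_one]
    refine Finset.sum_congr rfl fun J _ => ?_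
    simp [translateBox, ht]
  · intro J hJ
    obtain ⟨J₀, hJ₀, rfl⟩ := mem_translateTagged.1 hJ
    rw [tag_translateTagged]
    intro x hx
    have := hπ.1 J₀ hJ₀ (mem_Icc_translateBox.1 hx)
    rw [Metric.mem_closedBall] at this ⊢
    rwa [← dist_add_right (x - t) _ t, sub_add_cancel] at this
  · intro J hJ
    obtain ⟨J₀, hJ₀, rfl⟩ := mem_translateTagged.1 hJ
    rw [tag_translateTagged]
    exact mem_Icc_translateBox.2 (by simpa using hπ.2 rfl J₀ hJ₀)

theorem isHKPrimitive_zero (a b : ℝ) : IsHKPrimitive (fun _ => 0) (fun _ => 0) a b :=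
  fun u v _ huv _ => ⟨huv, by simpa using hasIntegral_zero⟩

/-- The fundamental theorem of calculus for the Henstock–Kurzweil integral. -/
theorem hasHKIntegral_of_hasDerivAt {φ G : ℝ → ℝ} {a b : ℝ} (hab : a < b)
    (h : ∀ x, HasDerivAt G (φ x) x) : HasHKIntegral φ a b (G b - G a) := by
  refine (isHKPrimitive_zero a b).hasHKIntegral_of_abs_sub_le hab le_rfl fun ε hε => ?_
  have : ∀ ξ, ∃ δ > 0, ∀ x, |x - ξ| ≤ δ → |G x - G ξ - (x - ξ) * φ ξ| ≤ ε * |x - ξ| := by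
    intro ξ
    have := (hasDerivAt_iff_isLittleO.1 (h ξ)).def hε
    obtain ⟨δ, hδ, H⟩ := Metric.nhds_basis_closedBall.mem_iff.1 this
    exact ⟨δ, hδ, fun x hx => H hx⟩
  choose δ hδ H using this
  refine ⟨δ, hδ, fun u ξ v _ huξ hξv _ _ h1 h2 => ?_⟩
  have e1 := H ξ u (by rw [abs_le]; constructor <;> linarith [hδ ξ])
  have e2 := H ξ v (by rw [abs_le]; constructor <;> linarith [hδ ξ])
  rw [abs_of_nonpos (by linarith : u - ξ ≤ 0), abs_le] at e1
  rw [abs_of_nonneg (by linarith : 0 ≤ v - ξ), abs_le] at e2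
  simp only [sub_self, zero_mul, zero_add]
  rw [abs_le]
  constructor <;> linarith

/-- Integration by parts for the Henstock–Kurzweil integral. -/
theorem IsHKPrimitive.hasHKIntegral_mul {f F g g' : ℝ → ℝ} {a b : ℝ} (h : IsHKPrimitive f F a b)
    (hab : a < b) (hF : Continuous F) (hg : ∀ x, HasDerivAt g (g' x) x) (hg' : Continuous g') :
    HasHKIntegral (fun x => f x * g x) a b (F b * g b - F a * g a - ∫ x in a..b, F x * g' x) := by
  have hgc : Continuous g := continuous_iff_continuousAt.2 fun x => (hg x).continuousAt
  obtain ⟨C, hC⟩ := isCompact_Icc.exists_bound_of_continuousOn (s := Icc a b) hgc.continuousOn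
  obtain ⟨M, hM⟩ := isCompact_Icc.exists_bound_of_continuousOn (s := Icc a b) hg'.continuousOn
  have hC0 : 0 ≤ C := (norm_nonneg _).trans (hC a ⟨le_rfl, hab.le⟩)
  have hM0 : 0 ≤ M := (norm_nonneg _).trans (hM a ⟨le_rfl, hab.le⟩)
  have hint : ∀ (c u v : ℝ), IntervalIntegrable (fun x => (c - F x) * g' x) volume u v :=
    fun c u v => Continuous.intervalIntegrable (by fun_prop) _ _
  have hint' : ∀ (u v : ℝ), IntervalIntegrable (fun x => F x * g' x) volume u v :=
    fun u v => Continuous.intervalIntegrable (by fun_prop) _ _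
  have hcint : ∀ (c u v : ℝ),
      ∫ x in u..v, (c - F x) * g' x = c * (g v - g u) - ∫ x in u..v, F x * g' x := by
    intro c u v
    rw [← intervalIntegral.integral_eq_sub_of_hasDerivAt (fun x _ => hg x)
      (hg'.intervalIntegrable _ _), ← intervalIntegral.integral_const_mul,
      ← intervalIntegral.integral_sub ((hg'.intervalIntegrable _ _).const_mul _) (hint' _ _)]
    exact intervalIntegral.integral_congr fun x _ => by ring
  have main := h.hasHKIntegral_of_abs_sub_le (φ := fun x => f x * g x)
    (G := fun x => F x * g x - ∫ y in a..x, F y * g' y) hab hC0 fun ε hε => ?_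
  · simp only [intervalIntegral.integral_same, sub_zero] at main
    convert main using 1
    ring
  obtain ⟨η, hη, hηM⟩ : ∃ η > 0, 2 * η * M ≤ ε := by
    refine ⟨ε / (2 * (M + 1)), by positivity, ?_⟩
    rw [show 2 * (ε / (2 * (M + 1))) * M = ε * (M / (M + 1)) by field_simp]
    exact mul_le_of_le_one_right hε.le ((div_le_one (by positivity)).2 (by linarith))
  have : ∀ ξ, ∃ δ > 0, ∀ x, |x - ξ| ≤ δ → |F x - F ξ| ≤ η := by
    intro ξ
    have := hF.continuousAt.preimage_mem_nhds (Metric.closedBall_mem_nhds (F ξ) hη)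
    obtain ⟨δ, hδ, H⟩ := Metric.nhds_basis_closedBall.mem_iff.1 this
    exact ⟨δ, hδ, fun x hx => H hx⟩
  choose δ hδ Hδ using this
  refine ⟨δ, hδ, fun u ξ v hau huξ hξv hvb huv h1 h2 => ?_⟩
  have hb : ∀ x ∈ Icc u v, ∀ y ∈ Icc u v, |F y - F x| ≤ 2 * η := by
    intro x hx y hy
    have e1 := abs_le.1 (Hδ ξ x (abs_le.2 ⟨by linarith [hx.1], by linarith [hx.2]⟩))
    have e2 := abs_le.1 (Hδ ξ y (abs_le.2 ⟨by linarith [hy.1], by linarith [hy.2]⟩))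
    exact abs_le.2 ⟨by linarith, by linarith⟩
  have bound : ∀ y ∈ Icc u v, ∀ p q, u ≤ p → p ≤ q → q ≤ v →
      |∫ x in p..q, (F y - F x) * g' x| ≤ ε * (q - p) := by
    intro y hy p q hp hpq hq
    have := intervalIntegral.norm_integral_le_of_norm_le_const (a := p) (b := q) (C := ε)
      (f := fun x => (F y - F x) * g' x) fun x hx => by
        rw [uIoc_of_le hpq] at hx
        have hx' : x ∈ Icc u v := ⟨by linarith [hx.1], by linarith [hx.2]⟩
        rw [norm_mul]
        exact (mul_le_mul (hb x hx' y hy) (hM x ⟨by linarith [hx'.1], by linarith [hx'.2]⟩)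
          (norm_nonneg _) (by positivity)).trans hηM
    rwa [abs_of_nonneg (by linarith : 0 ≤ q - p)] at this
  have b1 := bound v ⟨huv.le, le_rfl⟩ ξ v huξ hξv le_rfl
  have b2 := bound u ⟨le_rfl, huv.le⟩ u ξ le_rfl huξ hξv
  have hgξ := hC ξ ⟨by linarith, by linarith⟩
  have split : (∫ y in a..v, F y * g' y) - ∫ y in a..u, F y * g' y =
      (∫ y in u..ξ, F y * g' y) + ∫ y in ξ..v, F y * g' y := by
    rw [intervalIntegral.integral_interval_sub_left (hint' _ _) (hint' _ _),
      intervalIntegral.integral_add_adjacent_intervals (hint' _ _) (hint' _ _)]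
  have e : (v - u) * (f ξ * g ξ) - ((F v * g v - ∫ y in a..v, F y * g' y) -
      (F u * g u - ∫ y in a..u, F y * g' y)) =
      g ξ * ((v - u) * f ξ - (F v - F u)) - (∫ x in u..ξ, (F u - F x) * g' x)
        - ∫ x in ξ..v, (F v - F x) * g' x := by
    rw [hcint, hcint]
    linear_combination split
  simp only [e]
  calc _ ≤ |g ξ * ((v - u) * f ξ - (F v - F u))| + |∫ x in u..ξ, (F u - F x) * g' x|
        + |∫ x in ξ..v, (F v - F x) * g' x| :=
        (abs_sub _ _).trans (add_le_add_left (abs_sub _ _) _)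
    _ ≤ C * |(v - u) * f ξ - (F v - F u)| + ε * (ξ - u) + ε * (v - ξ) := by
        rw [abs_mul]
        gcongr
        exact hgξ
    _ = _ := by ring

theorem hkIntegrable_of_alexiewiczNorm_lt_top {f : ℝ → ℝ} (hf : alexiewiczNorm f < ⊤) {a b : ℝ}
    (hab : a < b) (hba : b - a ≤ 2 * Real.pi) : HKIntegrable f a b := by
  by_contra h
  have : (⊤ : ℝ≥0∞) ≤ alexiewiczNorm f := by
    unfold alexiewiczNorm
    refine le_trans ?_ (le_iSup₂_of_le a b (le_iSup₂_of_le hab hba le_rfl))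
    rw [if_neg h]
  exact absurd hf (not_lt.2 this)

theorem ofReal_abs_hkIntegral_le_alexiewiczNorm {f : ℝ → ℝ} {a b y : ℝ}
    (h : HasHKIntegral f a b y) (hba : b - a ≤ 2 * Real.pi) :
    ENNReal.ofReal |y| ≤ alexiewiczNorm f := by
  unfold alexiewiczNorm
  refine le_trans ?_ (le_iSup₂_of_le a b (le_iSup₂_of_le h.lt hba le_rfl))
  rw [if_pos ⟨y, h⟩, h.hkIntegral_eq]

theorem alexiewiczNorm_le {f : ℝ → ℝ} {c : ℝ}
    (h : ∀ a b, a < b → b - a ≤ 2 * Real.pi → ∃ y, HasHKIntegral f a b y ∧ |y| ≤ c) :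
    alexiewiczNorm f ≤ ENNReal.ofReal c := by
  unfold alexiewiczNorm
  refine iSup₂_le fun a b => iSup₂_le fun hab hba => ?_
  obtain ⟨y, hy, hyc⟩ := h a b hab hba
  rw [if_pos ⟨y, hy⟩, hy.hkIntegral_eq]
  exact ENNReal.ofReal_le_ofReal hyc

/-- A function in `HK` is, up to its mean, the generalized derivative of a continuous periodic
function. -/
theorem exists_periodic_primitive {f : ℝ → ℝ} (hf : f ∈ HK) :
    ∃ (m : ℝ) (G : ℝ → ℝ), Continuous G ∧ Function.Periodic G (2 * Real.pi) ∧
      ∀ a b, a < b → b - a ≤ 2 * Real.pi →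
        HasHKIntegral f a b ((m * b + G b) - (m * a + G a)) := by
  obtain ⟨hper, hfin⟩ := hf
  have hπ := Real.pi_pos
  have hp : 0 < 2 * Real.pi := by positivity
  have : Fact (0 < 2 * Real.pi) := ⟨hp⟩
  have hint := fun a b (h : a < b) => hkIntegrable_of_alexiewiczNorm_lt_top hfin h
  have hI := hint (-Real.pi) Real.pi (by linarith) (by linarith)
  have hprim := hI.isHKPrimitive
  set F : ℝ → ℝ := fun x => hkIntegral f (-Real.pi) x with hF
  have hF0 : F (-Real.pi) = 0 := by simp [hF, hkIntegral]
  set m : ℝ := F Real.pi / (2 * Real.pi) with hm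
  have hmπ : m * (2 * Real.pi) = F Real.pi := by rw [hm]; field_simp
  set G₀ : ℝ → ℝ := fun x => F x - m * (x + Real.pi) with hG₀
  have hend : G₀ (-Real.pi) = G₀ (-Real.pi + 2 * Real.pi) := by
    simp only [hG₀, show -Real.pi + 2 * Real.pi = Real.pi by ring, hF0]
    linarith
  have hcont : ContinuousOn G₀ (Icc (-Real.pi) (-Real.pi + 2 * Real.pi)) := by
    rw [show -Real.pi + 2 * Real.pi = Real.pi by ring]
    exact (hprim.continuousOn (by linarith)).sub (by fun_prop)
  have hlift := AddCircle.liftIco_continuous hend hcont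
  set G : ℝ → ℝ := fun x => AddCircle.liftIco (2 * Real.pi) (-Real.pi) G₀ (x : AddCircle (2 * Real.pi))
  have hGper : Function.Periodic G (2 * Real.pi) := fun x => by
    simp only [G, AddCircle.coe_add_period]
  have hGIco : ∀ x ∈ Ico (-Real.pi) Real.pi, G x = G₀ x := fun x hx =>
    AddCircle.liftIco_coe_apply ⟨hx.1, by linarith [hx.2]⟩
  have hGIcc : ∀ x ∈ Icc (-Real.pi) Real.pi, G x = G₀ x := fun x hx => by
    rcases hx.2.eq_or_lt with rfl | h
    · have h1 := hGper (-Real.pi)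
      rw [show -Real.pi + 2 * Real.pi = Real.pi by ring] at h1 hend
      rw [h1, hGIco _ ⟨le_rfl, by linarith⟩, hend]
    · exact hGIco x ⟨hx.1, h⟩
  have hbase : ∀ u v, -Real.pi ≤ u → u < v → v ≤ Real.pi →
      HasHKIntegral f u v ((m * v + G v) - (m * u + G u)) := by
    intro u v hu huv hv
    convert hprim u v hu huv hv using 1
    rw [hGIcc u ⟨hu, by linarith⟩, hGIcc v ⟨by linarith, hv⟩]
    simp only [hG₀]
    ring
  refine ⟨m, G, hlift.comp (AddCircle.continuous_mk' _), hGper, ?_⟩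
  have hmid : ∀ u v, -Real.pi ≤ u → u < Real.pi → u < v → v - u ≤ 2 * Real.pi →
      HasHKIntegral f u v ((m * v + G v) - (m * u + G u)) := by
    intro u v hu huπ huv hvu
    rcases le_or_gt v Real.pi with hv | hv
    · exact hbase u v hu huv hv
    have h1 := (hbase u Real.pi hu huπ le_rfl).hkIntegral_eq
    have h2 : HasHKIntegral f Real.pi v ((m * v + G v) - (m * Real.pi + G Real.pi)) := by
      have := hbase (-Real.pi) (v - 2 * Real.pi) le_rfl (by linarith) (by linarith)
      have h3 := HasHKIntegral.comp_add_right (f := f) (T := -(2 * Real.pi)) (a := Real.pi) (b := v)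
        (by convert this using 1 <;> ring)
      convert h3.congr (g := f) (fun x => by rw [← sub_eq_add_neg, hper.sub_eq]) using 1
      have e := hGper (-Real.pi)
      rw [show -Real.pi + 2 * Real.pi = Real.pi by ring] at e
      rw [hGper.sub_eq, e]
      ring
    have h := (hint u v huv hvu)
    convert h.hasHKIntegral using 1
    rw [← hkIntegral_add_adjacent h huπ hv, h1, h2.hkIntegral_eq]
    ring
  intro a b hab hba
  obtain ⟨n, hn, -⟩ := existsUnique_sub_zsmul_mem_Ico hp a (-Real.pi)
  have h := hmid (a - n • (2 * Real.pi)) (b - n • (2 * Real.pi)) hn.1 (by linarith [hn.2])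
    (by linarith) (by linarith)
  have h3 := HasHKIntegral.comp_add_right (f := f) (T := -(n • (2 * Real.pi))) (a := a) (b := b)
    (y := (m * (b - n • (2 * Real.pi)) + G (b - n • (2 * Real.pi))) -
      (m * (a - n • (2 * Real.pi)) + G (a - n • (2 * Real.pi))))
    (by rwa [← sub_eq_add_neg, ← sub_eq_add_neg])
  convert h3.congr (g := f) (fun x => by rw [← sub_eq_add_neg, hper.sub_zsmul_eq]) using 1
  rw [hGper.sub_zsmul_eq, hGper.sub_zsmul_eq]
  ring

/-- The normalized Poisson kernel with pole `e^{iφ}`, as a function of `φ`. -/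
noncomputable def boundaryKernel (z : ℂ) (φ : ℝ) : ℝ :=
  (2 * Real.pi)⁻¹ * (herglotzRieszKernel 0 z (circleMap 0 1 φ)).re

/-- The derivative of `boundaryKernel z`. -/
noncomputable def boundaryKernelDeriv (z : ℂ) (φ : ℝ) : ℝ :=
  (2 * Real.pi)⁻¹ *
    (-(Complex.I * z * (2 * circleMap 0 1 φ / (circleMap 0 1 φ - z) ^ 2))).re

theorem circleMap_sub_ne_zero {z : ℂ} (hz : z ∈ Metric.ball (0 : ℂ) 1) (φ : ℝ) :
    circleMap 0 1 φ - z ≠ 0 := by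
  intro h
  rw [sub_eq_zero] at h
  rw [mem_ball_zero_iff, ← h] at hz
  simp at hz

theorem boundaryKernel_polar {r θ : ℝ} (φ : ℝ) :
    boundaryKernel (polar r θ) φ = poissonKernel r (φ - θ) := by
  have h : (herglotzRieszKernel 0 (polar r θ) (circleMap 0 1 φ)).re =
      _root_.poissonKernel 0 (polar r θ) (circleMap 0 1 φ) := by
    rw [poissonKernel_eq_re_herglotzRieszKernel]; rfl
  have h1 : ‖polar r θ‖ ^ 2 = r ^ 2 := by
    simp [polar, Complex.norm_exp_ofReal_mul_I]
  have h2 : ‖circleMap 0 1 φ - polar r θ‖ ^ 2 = 1 - 2 * r * Real.cos (φ - θ) + r ^ 2 := by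
    rw [← Complex.normSq_eq_norm_sq, Complex.normSq_apply]
    simp only [circleMap, polar, Complex.exp_ofReal_mul_I_re, Complex.exp_ofReal_mul_I_im,
      Complex.sub_re, Complex.sub_im, Complex.re_ofReal_mul, Complex.im_ofReal_mul, zero_add,
      Real.cos_sub]
    nlinarith [Real.sin_sq_add_cos_sq φ, Real.sin_sq_add_cos_sq θ]
  rw [boundaryKernel, h, _root_.poissonKernel, sub_zero, sub_zero, h1, h2, poissonKernel]
  simp only [norm_circleMap_zero]
  rw [← div_eq_inv_mul, div_div]
  norm_num
  ring_nf

theorem polar_norm_arg (z : ℂ) : polar ‖z‖ z.arg = z :=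
  Complex.norm_mul_exp_arg_mul_I z

theorem hasDerivAt_boundaryKernel {z : ℂ} (hz : z ∈ Metric.ball (0 : ℂ) 1) (φ : ℝ) :
    HasDerivAt (boundaryKernel z) (boundaryKernelDeriv z φ) φ := by
  have h0 := circleMap_sub_ne_zero hz φ
  have h1 := hasDerivAt_circleMap 0 1 φ
  have h2 := (h1.add_const z).div (h1.sub_const z) h0
  have h3 := (Complex.reCLM.hasFDerivAt.comp_hasDerivAt φ h2).const_mul (2 * Real.pi)⁻¹
  have h4 : boundaryKernel z = fun y => (2 * Real.pi)⁻¹ * (Complex.reCLM ∘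
      ((fun x => circleMap 0 1 x + z) / fun x => circleMap 0 1 x - z)) y := by
    ext x
    simp [boundaryKernel, herglotzRieszKernel]
  rw [h4]
  refine h3.congr_deriv ?_
  rw [boundaryKernelDeriv, Complex.reCLM_apply]
  congr 2
  field_simp
  ring

theorem continuous_boundaryKernelDeriv {z : ℂ} (hz : z ∈ Metric.ball (0 : ℂ) 1) :
    Continuous (boundaryKernelDeriv z) := by
  have : Continuous fun φ => 2 * circleMap 0 1 φ / (circleMap 0 1 φ - z) ^ 2 :=
    Continuous.div (by fun_prop) (by fun_prop) fun φ => pow_ne_zero 2 (circleMap_sub_ne_zero hz φ)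
  unfold boundaryKernelDeriv
  fun_prop

theorem continuous_boundaryKernel {z : ℂ} (hz : z ∈ Metric.ball (0 : ℂ) 1) :
    Continuous (boundaryKernel z) :=
  continuous_iff_continuousAt.2 fun φ => (hasDerivAt_boundaryKernel hz φ).continuousAt

theorem circleAverage_eq_integral_neg_pi_pi {E : Type*} [NormedAddCommGroup E] [NormedSpace ℝ E]
    (H : ℂ → E) : Real.circleAverage H 0 1 =
      (2 * Real.pi)⁻¹ • ∫ φ in -Real.pi..Real.pi, H (circleMap 0 1 φ) := by
  rw [Real.circleAverage_eq_integral_add (-Real.pi),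
    intervalIntegral.integral_comp_add_right (fun φ => H (circleMap 0 1 φ))]
  congr 2 <;> ring

theorem integral_boundaryKernel {z : ℂ} (hz : z ∈ Metric.ball (0 : ℂ) 1) :
    ∫ φ in -Real.pi..Real.pi, boundaryKernel z φ = 1 := by
  have h := DiffContOnCl.circleAverage_re_herglotzRieszKernel_smul (E := ℂ) (f := fun _ => 1)
    (c := 0) diffContOnCl_const hz
  have := congrArg Complex.re h
  rw [circleAverage_eq_integral_neg_pi_pi] at this
  simp only [boundaryKernel, intervalIntegral.integral_const_mul]
  simp only [Pi.smul_apply', Function.comp_apply, Complex.real_smul, mul_one,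
    intervalIntegral.integral_ofReal] at this
  exact_mod_cast this

theorem periodic_apply_arg {G : ℝ → ℝ} (hG : Function.Periodic G (2 * Real.pi)) (φ : ℝ) :
    G (circleMap 0 1 φ).arg = G φ := by
  have h : ((circleMap 0 1 φ).arg : Real.Angle) = φ := by
    simp [circleMap, Complex.arg_exp_mul_I, Real.Angle.coe_toIocMod]
  obtain ⟨k, hk⟩ := Real.Angle.angle_eq_iff_two_pi_dvd_sub.1 h
  rw [eq_add_of_sub_eq hk, add_comm, mul_comm]
  simpa using hG.zsmul k φ

/-- The Herglotz integral of a periodic function. -/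
noncomputable def herglotzIntegral (G : ℝ → ℝ) (w : ℂ) : ℂ :=
  Real.circleAverage (fun ζ => herglotzRieszKernel 0 w ζ • ((G ζ.arg : ℝ) : ℂ)) 0 1

/-- The derivative of `herglotzIntegral G`. -/
noncomputable def herglotzIntegralDeriv (G : ℝ → ℝ) (w : ℂ) : ℂ :=
  Real.circleAverage (fun ζ => (2 * ζ / (ζ - w) ^ 2) • ((G ζ.arg : ℝ) : ℂ)) 0 1

theorem hasDerivAt_herglotzIntegral {G : ℝ → ℝ} (hGc : Continuous G)
    (hG : Function.Periodic G (2 * Real.pi)) {w : ℂ} (hw : w ∈ Metric.ball (0 : ℂ) 1) :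
    HasDerivAt (herglotzIntegral G) (herglotzIntegralDeriv G w) w := by
  refine hasDerivAt_circleAverage_herglotzRieszKernel_smul ?_ hw
  simp only [CircleIntegrable, periodic_apply_arg hG]
  exact Continuous.intervalIntegrable (by fun_prop) _ _

theorem re_herglotzIntegral {G : ℝ → ℝ} (hGc : Continuous G)
    (hG : Function.Periodic G (2 * Real.pi)) {w : ℂ} (hw : w ∈ Metric.ball (0 : ℂ) 1) :
    (herglotzIntegral G w).re = ∫ φ in -Real.pi..Real.pi, G φ * boundaryKernel w φ := by
  have hc : Continuous fun φ => herglotzRieszKernel 0 w (circleMap 0 1 φ) • (G φ : ℂ) := by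
    have : Continuous fun φ => herglotzRieszKernel 0 w (circleMap 0 1 φ) := by
      simp only [herglotzRieszKernel, sub_zero]
      exact Continuous.div (by fun_prop) (by fun_prop) (circleMap_sub_ne_zero hw)
    fun_prop
  have := Complex.reCLM.intervalIntegral_comp_comm
    (hc.intervalIntegrable (μ := volume) (-Real.pi) Real.pi)
  rw [herglotzIntegral, circleAverage_eq_integral_neg_pi_pi, Complex.smul_re]
  simp only [periodic_apply_arg hG]
  rw [← Complex.reCLM_apply, ← this, smul_eq_mul, ← intervalIntegral.integral_const_mul]
  refine intervalIntegral.integral_congr fun φ _ => ?_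
  simp [boundaryKernel]
  ring

theorem re_I_mul_herglotzIntegralDeriv {G : ℝ → ℝ} (hGc : Continuous G)
    (hG : Function.Periodic G (2 * Real.pi)) {w : ℂ} (hw : w ∈ Metric.ball (0 : ℂ) 1) :
    (Complex.I * w * herglotzIntegralDeriv G w).re =
      -∫ φ in -Real.pi..Real.pi, G φ * boundaryKernelDeriv w φ := by
  have hc : Continuous fun φ => Complex.I * w *
      ((2 * circleMap 0 1 φ / (circleMap 0 1 φ - w) ^ 2) • (G φ : ℂ)) := by
    have : Continuous fun φ => 2 * circleMap 0 1 φ / (circleMap 0 1 φ - w) ^ 2 :=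
      Continuous.div (by fun_prop) (by fun_prop)
        fun φ => pow_ne_zero 2 (circleMap_sub_ne_zero hw φ)
    fun_prop
  have := Complex.reCLM.intervalIntegral_comp_comm
    (hc.intervalIntegrable (μ := volume) (-Real.pi) Real.pi)
  rw [herglotzIntegralDeriv, circleAverage_eq_integral_neg_pi_pi, mul_smul_comm, Complex.smul_re]
  simp only [periodic_apply_arg hG]
  rw [← intervalIntegral.integral_const_mul, ← Complex.reCLM_apply, ← this, smul_eq_mul,
    ← intervalIntegral.integral_const_mul, ← intervalIntegral.integral_neg]
  refine intervalIntegral.integral_congr fun φ _ => ?_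
  simp only [boundaryKernelDeriv, Complex.reCLM_apply, smul_eq_mul, ← mul_assoc,
    Complex.re_mul_ofReal, Complex.neg_re]
  ring

/-- The Poisson integral as a Henstock–Kurzweil integral. -/
theorem hasHKIntegral_mul_boundaryKernel {f G : ℝ → ℝ} {m : ℝ} (hGc : Continuous G)
    (hG : Function.Periodic G (2 * Real.pi))
    (hf : ∀ a b, a < b → b - a ≤ 2 * Real.pi →
      HasHKIntegral f a b ((m * b + G b) - (m * a + G a))) {z : ℂ}
    (hz : z ∈ Metric.ball (0 : ℂ) 1) :
    HasHKIntegral (fun φ => f φ * boundaryKernel z φ) (-Real.pi) Real.pi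
      (m + (Complex.I * z * herglotzIntegralDeriv G z).re) := by
  have hπ := Real.pi_pos
  have hprim : IsHKPrimitive f (fun x => m * x + G x) (-Real.pi) Real.pi :=
    fun u v hu huv hv => hf u v huv (by linarith)
  have h := hprim.hasHKIntegral_mul (by linarith) (by fun_prop) (hasDerivAt_boundaryKernel hz)
    (continuous_boundaryKernelDeriv hz)
  convert h using 1
  have hK := continuous_boundaryKernel hz
  have hK' := continuous_boundaryKernelDeriv hz
  have hparts := intervalIntegral.integral_mul_deriv_eq_deriv_mul (a := -Real.pi) (b := Real.pi)
    (u := fun x => m * x) (u' := fun _ => m) (fun x _ => by simpa using (hasDerivAt_id x).const_mul m)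
    (fun x _ => hasDerivAt_boundaryKernel hz x) (by simp) (hK'.intervalIntegrable _ _)
  rw [intervalIntegral.integral_const_mul, integral_boundaryKernel hz] at hparts
  have hsplit : ∫ x in -Real.pi..Real.pi, (m * x + G x) * boundaryKernelDeriv z x =
      (∫ x in -Real.pi..Real.pi, m * x * boundaryKernelDeriv z x) +
        ∫ x in -Real.pi..Real.pi, G x * boundaryKernelDeriv z x := by
    rw [← intervalIntegral.integral_add (Continuous.intervalIntegrable (by fun_prop) _ _)
      (Continuous.intervalIntegrable (by fun_prop) _ _)]
    exact intervalIntegral.integral_congr fun x _ => by ring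
  have hKπ : boundaryKernel z (-Real.pi) = boundaryKernel z Real.pi := by
    simp [boundaryKernel, circleMap, Complex.exp_neg]
  have hGπ : G (-Real.pi) = G Real.pi := by
    rw [← hG (-Real.pi)]; congr 1; ring
  rw [re_I_mul_herglotzIntegralDeriv hGc hG hz, hsplit, hparts, hKπ, hGπ]
  ring

theorem polar_mem_ball {r : ℝ} (θ : ℝ) (h0 : 0 ≤ r) (h1 : r < 1) :
    polar r θ ∈ Metric.ball (0 : ℂ) 1 := by
  simp [polar, Complex.norm_exp_ofReal_mul_I, abs_of_nonneg h0, h1]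

theorem hasDerivAt_polar (r θ : ℝ) : HasDerivAt (polar r) (Complex.I * polar r θ) θ := by
  have h := ((Complex.ofRealCLM.hasDerivAt (x := θ)).mul_const Complex.I).cexp.const_mul (r : ℂ)
  refine h.congr_deriv ?_
  simp [polar]
  ring

theorem hasDerivAt_re_comp_polar {h : ℂ → ℂ} {h' : ℂ} {r θ : ℝ}
    (H : HasDerivAt h h' (polar r θ)) :
    HasDerivAt (fun θ => (h (polar r θ)).re) (Complex.I * polar r θ * h').re θ := by
  have h1 := Complex.reCLM.hasFDerivAt.comp_hasDerivAt θ (H.comp_of_eq θ (hasDerivAt_polar r θ) rfl)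
  refine h1.congr_deriv ?_
  rw [Complex.reCLM_apply, mul_comm]

theorem exists_abs_sub_le_add_mul_one_sub_cos {G : ℝ → ℝ} (hGc : Continuous G)
    (hG : Function.Periodic G (2 * Real.pi)) {ε : ℝ} (hε : 0 < ε) :
    ∃ M, 0 ≤ M ∧ ∀ x y, |G x - G y| ≤ ε + M * (1 - Real.cos (x - y)) := by
  have hπ := Real.pi_pos
  have hp : 0 < 2 * Real.pi := by positivity
  obtain ⟨C, hC⟩ := isCompact_Icc.exists_bound_of_continuousOn
    (s := Icc (-(2 * Real.pi)) (2 * Real.pi)) hGc.continuousOn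
  have huc := (isCompact_Icc (a := -(2 * Real.pi)) (b := 2 * Real.pi)).uniformContinuousOn_of_continuous
    hGc.continuousOn
  obtain ⟨δ, hδ, H⟩ := Metric.uniformContinuousOn_iff.1 huc ε hε
  have hC0 : 0 ≤ C := (norm_nonneg _).trans (hC 0 ⟨by linarith, by linarith⟩)
  set d := min δ 1 with hd
  have hd0 : 0 < d := lt_min hδ one_pos
  have hd1 : d ≤ 1 := min_le_right _ _
  have hcos : Real.cos d < 1 := by
    rw [← Real.cos_zero]
    exact Real.cos_lt_cos_of_nonneg_of_le_pi le_rfl (by linarith [Real.pi_gt_three]) hd0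
  refine ⟨2 * C / (1 - Real.cos d), by have := sub_pos.2 hcos; positivity, ?_⟩
  have key : ∀ y s, y ∈ Ico (-Real.pi) (-Real.pi + 2 * Real.pi) →
      s ∈ Ico (-Real.pi) (-Real.pi + 2 * Real.pi) →
      |G (y + s) - G y| ≤ ε + 2 * C / (1 - Real.cos d) * (1 - Real.cos s) := by
    rintro y s ⟨hy1, hy2⟩ ⟨hs1, hs2⟩
    have hx : y + s ∈ Icc (-(2 * Real.pi)) (2 * Real.pi) := ⟨by linarith, by linarith⟩
    have hy : y ∈ Icc (-(2 * Real.pi)) (2 * Real.pi) := ⟨by linarith, by linarith⟩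
    have hnn : 0 ≤ 2 * C / (1 - Real.cos d) * (1 - Real.cos s) := by
      have := sub_pos.2 hcos
      have := sub_nonneg.2 (Real.cos_le_one s)
      positivity
    rcases lt_or_ge |s| d with hsd | hsd
    · have := H _ hx _ hy (by
        rw [Real.dist_eq, add_sub_cancel_left]
        exact hsd.trans_le (min_le_left _ _))
      rw [Real.dist_eq] at this
      linarith
    · have hle : Real.cos s ≤ Real.cos d := by
        rw [← Real.cos_abs s]
        exact Real.cos_le_cos_of_nonneg_of_le_pi hd0.le (abs_le.2 ⟨by linarith, by linarith⟩) hsd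
      have h1 : 2 * C ≤ 2 * C / (1 - Real.cos d) * (1 - Real.cos s) := by
        rw [div_mul_eq_mul_div, le_div_iff₀ (by linarith)]
        exact mul_le_mul_of_nonneg_left (by linarith) (by linarith)
      have h2 : |G (y + s) - G y| ≤ 2 * C := by
        have e1 := hC _ hx
        have e2 := hC _ hy
        rw [Real.norm_eq_abs] at e1 e2
        linarith [abs_sub (G (y + s)) (G y)]
      linarith
  intro x y
  obtain ⟨n, hn, -⟩ := existsUnique_sub_zsmul_mem_Ico hp y (-Real.pi)
  obtain ⟨k, hk, -⟩ := existsUnique_sub_zsmul_mem_Ico hp (x - y) (-Real.pi)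
  have := key _ _ hn hk
  rw [show y - n • (2 * Real.pi) + (x - y - k • (2 * Real.pi)) = x - (n + k) • (2 * Real.pi) by
    rw [add_smul]; ring, hG.sub_zsmul_eq, hG.sub_zsmul_eq, Real.cos_periodic.sub_zsmul_eq] at this
  exact this

theorem poissonKernel_nonneg {r t : ℝ} (h0 : 0 ≤ r) (h1 : r < 1) : 0 ≤ poissonKernel r t := by
  have : 0 ≤ 1 - 2 * r * Real.cos t + r ^ 2 := by
    nlinarith [Real.cos_le_one t, sq_nonneg (1 - r)]
  have : 0 ≤ 1 - r ^ 2 := by nlinarith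
  have := Real.pi_pos
  unfold poissonKernel
  positivity

theorem one_sub_cos_mul_poissonKernel_le {r t : ℝ} (h0 : 0 < r) (h1 : r < 1) :
    (1 - Real.cos t) * poissonKernel r t ≤ (1 - r ^ 2) / (2 * r) / (2 * Real.pi) := by
  have hπ := Real.pi_pos
  have hc := Real.cos_le_one t
  have hden : 0 < 1 - 2 * r * Real.cos t + r ^ 2 := by
    nlinarith [mul_pos (sub_pos.2 h1) (sub_pos.2 h1)]
  have h2 : 0 ≤ 1 - r ^ 2 := by nlinarith
  have h3 : (1 - Real.cos t) / (1 - 2 * r * Real.cos t + r ^ 2) ≤ 1 / (2 * r) := by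
    rw [div_le_div_iff₀ hden (by positivity)]
    nlinarith [sq_nonneg (1 - r)]
  calc (1 - Real.cos t) * poissonKernel r t
      = (1 - r ^ 2) / (2 * Real.pi) * ((1 - Real.cos t) / (1 - 2 * r * Real.cos t + r ^ 2)) := by
        unfold poissonKernel; field_simp
    _ ≤ (1 - r ^ 2) / (2 * Real.pi) * (1 / (2 * r)) := by gcongr
    _ = _ := by field_simp

/-- The classical Poisson integral of a continuous periodic function converges to it uniformly. -/
theorem eventually_abs_re_herglotzIntegral_sub_le {G : ℝ → ℝ} (hGc : Continuous G)
    (hG : Function.Periodic G (2 * Real.pi)) {ε : ℝ} (hε : 0 < ε) :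
    ∀ᶠ r in 𝓝[<] (1 : ℝ), ∀ θ, |(herglotzIntegral G (polar r θ)).re - G θ| ≤ ε := by
  obtain ⟨M, hM, H⟩ := exists_abs_sub_le_add_mul_one_sub_cos hGc hG (half_pos hε)
  have hlim : Tendsto (fun r : ℝ => M * ((1 - r ^ 2) / (2 * r))) (𝓝[<] 1) (𝓝 0) := by
    have : ContinuousAt (fun r : ℝ => M * ((1 - r ^ 2) / (2 * r))) 1 := by
      fun_prop (disch := norm_num)
    have := this.tendsto
    norm_num at this
    exact this.mono_left nhdsWithin_le_nhds
  have hpos : ∀ᶠ r in 𝓝[<] (1 : ℝ), 0 < r :=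
    nhdsWithin_le_nhds (lt_mem_nhds one_pos)
  filter_upwards [hlim.eventually_lt_const (half_pos hε), hpos, self_mem_nhdsWithin]
    with r hr h0 h1 θ
  have hz := polar_mem_ball θ h0.le h1
  have hK := continuous_boundaryKernel hz
  have hπ := Real.pi_pos
  have e : (herglotzIntegral G (polar r θ)).re - G θ =
      ∫ φ in -Real.pi..Real.pi, (G φ - G θ) * boundaryKernel (polar r θ) φ := by
    rw [re_herglotzIntegral hGc hG hz]
    conv_lhs => rw [← mul_one (G θ), ← integral_boundaryKernel hz]
    rw [← intervalIntegral.integral_const_mul, ← intervalIntegral.integral_sub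
      (Continuous.intervalIntegrable (by fun_prop) _ _)
      (Continuous.intervalIntegrable (by fun_prop) _ _)]
    exact intervalIntegral.integral_congr fun φ _ => by ring
  have hb : ∀ φ, ‖(G φ - G θ) * boundaryKernel (polar r θ) φ‖ ≤
      ε / 2 * boundaryKernel (polar r θ) φ + M * ((1 - r ^ 2) / (2 * r) / (2 * Real.pi)) := by
    intro φ
    rw [boundaryKernel_polar, norm_mul, Real.norm_eq_abs, Real.norm_eq_abs,
      abs_of_nonneg (poissonKernel_nonneg h0.le h1)]
    calc _ ≤ (ε / 2 + M * (1 - Real.cos (φ - θ))) * poissonKernel r (φ - θ) :=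
          mul_le_mul_of_nonneg_right (H φ θ) (poissonKernel_nonneg h0.le h1)
      _ = ε / 2 * poissonKernel r (φ - θ) +
          M * ((1 - Real.cos (φ - θ)) * poissonKernel r (φ - θ)) := by ring
      _ ≤ _ := by
          gcongr
          exact one_sub_cos_mul_poissonKernel_le h0 h1
  have := intervalIntegral.norm_integral_le_of_norm_le (a := -Real.pi) (b := Real.pi) (μ := volume)
    (by linarith) (Eventually.of_forall fun φ _ => hb φ)
    (Continuous.intervalIntegrable (by fun_prop) _ _)
  rw [intervalIntegral.integral_add (Continuous.intervalIntegrable (by fun_prop) _ _)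
    (by simp), intervalIntegral.integral_const_mul, integral_boundaryKernel hz,
    intervalIntegral.integral_const, ← e, Real.norm_eq_abs, smul_eq_mul] at this
  have e2 : (Real.pi - -Real.pi) * (M * ((1 - r ^ 2) / (2 * r) / (2 * Real.pi))) =
      M * ((1 - r ^ 2) / (2 * r)) := by field_simp; ring
  linarith

theorem alexiewiczNorm_sub_le (f g : ℝ → ℝ) :
    alexiewiczNorm (fun x => f x - g x) ≤ alexiewiczNorm f + alexiewiczNorm g := by
  by_cases hf : alexiewiczNorm f = ⊤
  · simp [hf]
  by_cases hg : alexiewiczNorm g = ⊤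
  · simp [hg]
  rw [← ENNReal.ofReal_toReal (ENNReal.add_ne_top.2 ⟨hf, hg⟩)]
  refine alexiewiczNorm_le fun a b hab hba => ?_
  have h1 := (hkIntegrable_of_alexiewiczNorm_lt_top (lt_top_iff_ne_top.2 hf) hab hba).hasHKIntegral
  have h2 := (hkIntegrable_of_alexiewiczNorm_lt_top (lt_top_iff_ne_top.2 hg) hab hba).hasHKIntegral
  refine ⟨_, h1.sub h2, ?_⟩
  have e1 := (ENNReal.ofReal_le_iff_le_toReal hf).1 (ofReal_abs_hkIntegral_le_alexiewiczNorm h1 hba)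
  have e2 := (ENNReal.ofReal_le_iff_le_toReal hg).1 (ofReal_abs_hkIntegral_le_alexiewiczNorm h2 hba)
  rw [ENNReal.toReal_add hf hg]
  exact (abs_sub _ _).trans (add_le_add e1 e2)

theorem IsDirichletSolution.harmonicOnNhd {f : ℝ → ℝ} {u : ℂ → ℝ} (h : IsDirichletSolution f u) :
    InnerProductSpace.HarmonicOnNhd u (Metric.ball 0 1) := fun z hz =>
  ⟨h.contDiffOn.contDiffAt (Metric.isOpen_ball.mem_nhds hz), by
    filter_upwards [Metric.isOpen_ball.mem_nhds hz] with w hw using h.laplacian_eq_zero w hw⟩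

/-- If the real part of a holomorphic function has boundary values `≤ 0` in a uniform sense, then
it is `≤ 0`. -/
theorem re_nonpos_of_eventually_re_le {B : ℂ → ℂ} (hB : DifferentiableOn ℂ B (Metric.ball 0 1))
    (h : ∀ ε > 0, ∀ᶠ r in 𝓝[<] (1 : ℝ), ∀ z : ℂ, ‖z‖ = r → (B z).re ≤ ε) {z : ℂ}
    (hz : z ∈ Metric.ball (0 : ℂ) 1) : (B z).re ≤ 0 := by
  refine le_of_forall_pos_le_add fun ε hε => ?_
  rw [zero_add]
  rw [mem_ball_zero_iff] at hz
  have hgt : ∀ᶠ r in 𝓝[<] (1 : ℝ), ‖z‖ < r := nhdsWithin_le_nhds (lt_mem_nhds hz)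
  obtain ⟨r, hr, hzr, hr1⟩ := ((h ε hε).and (hgt.and self_mem_nhdsWithin)).exists
  have hr0 : r ≠ 0 := ((norm_nonneg z).trans_lt hzr).ne'
  have hd : DiffContOnCl ℂ (fun w => Complex.exp (B w)) (Metric.ball 0 r) := by
    refine DifferentiableOn.diffContOnCl ?_
    rw [closure_ball _ hr0]
    exact (hB.mono (Metric.closedBall_subset_ball hr1)).cexp
  have := Complex.norm_le_of_forall_mem_frontier_norm_le Metric.isBounded_ball hd (C := Real.exp ε)
    (fun w hw => by
      rw [frontier_ball _ hr0, mem_sphere_zero_iff_norm] at hw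
      rw [Complex.norm_exp, Real.exp_le_exp]
      exact hr w hw)
    (subset_closure (mem_ball_zero_iff.2 hzr))
  rwa [Complex.norm_exp, Real.exp_le_exp] at this

/-- A harmonic function in the disc with boundary values `0` in the Alexiewicz norm vanishes. -/
theorem eq_zero_of_tendsto_alexiewiczNorm_zero {w : ℂ → ℝ}
    (hw : InnerProductSpace.HarmonicOnNhd w (Metric.ball 0 1))
    (h : Tendsto (fun r : ℝ => alexiewiczNorm (fun θ => w (polar r θ))) (𝓝[<] 1) (𝓝 0)) {z : ℂ}
    (hz : z ∈ Metric.ball (0 : ℂ) 1) : w z = 0 := by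
  obtain ⟨H, hH, hHw⟩ := hw.exists_analyticOnNhd_ball_re_eq
  have hk : DifferentiableOn ℂ (dslope H 0) (Metric.ball 0 1) :=
    (Complex.differentiableOn_dslope (Metric.ball_mem_nhds 0 one_pos)).2 hH.differentiableOn
  obtain ⟨K, hK⟩ := hk.isExactOn_ball
  set B : ℝ → ℂ → ℂ := fun t z =>
    t * H 0 - Complex.I * (K (polar 1 t * z) - K z) with hBdef
  have hnorm : ∀ t z, ‖polar 1 t * z‖ = ‖z‖ := fun t z => by
    simp [polar, Complex.norm_exp_ofReal_mul_I]
  have hrot : ∀ t, ∀ z ∈ Metric.ball (0 : ℂ) 1, polar 1 t * z ∈ Metric.ball (0 : ℂ) 1 :=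
    fun t z hz => by
      rw [mem_ball_zero_iff] at hz ⊢
      rwa [hnorm]
  have hB : ∀ t, DifferentiableOn ℂ (B t) (Metric.ball 0 1) := fun t z hz => by
    have h1 : DifferentiableAt ℂ K (polar 1 t * z) := (hK _ (hrot t z hz)).differentiableAt
    have h2 : DifferentiableAt ℂ K z := (hK z hz).differentiableAt
    have h3 : DifferentiableAt ℂ (fun z => K (polar 1 t * z)) z :=
      DifferentiableAt.comp z h1 (by fun_prop)
    exact (((h3.sub h2).const_mul _).const_sub _).differentiableWithinAt
  have hBt : ∀ z ∈ Metric.ball (0 : ℂ) 1, ∀ t,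
      HasDerivAt (fun t => (B t z).re) (w (polar 1 t * z)) t := by
    intro z hz t
    have h1 := (hK _ (hrot t z hz)).comp_of_eq t ((hasDerivAt_polar 1 t).mul_const z) rfl
    have h2 := ((Complex.ofRealCLM.hasDerivAt (x := t)).mul_const (H 0)).sub
      ((h1.sub_const (K z)).const_mul Complex.I)
    have h3 := Complex.reCLM.hasFDerivAt.comp_hasDerivAt t h2
    refine h3.congr_deriv ?_
    rw [← hHw (hrot t z hz), Complex.reCLM_apply]
    congr 1
    have h4 := sub_smul_dslope H 0 (polar 1 t * z)
    rw [sub_zero, smul_eq_mul] at h4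
    rw [Complex.ofRealCLM_apply, Complex.ofReal_one]
    linear_combination h4 - (polar 1 t * z * dslope H 0 (polar 1 t * z)) * Complex.I_mul_I
  have hpolar : ∀ r s θ, polar 1 s * polar r θ = polar r (s + θ) := by
    intro r s θ
    simp only [polar, Complex.ofReal_add, add_mul, Complex.exp_add, Complex.ofReal_one]
    ring
  have hbound : ∀ ε > 0, ∀ᶠ r in 𝓝[<] (1 : ℝ), ∀ t, 0 < t → t ≤ 2 * Real.pi →
      ∀ z : ℂ, ‖z‖ = r → |(B t z).re| ≤ ε := by
    intro ε hε
    have := h.eventually (gt_mem_nhds (ENNReal.ofReal_pos.2 hε))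
    filter_upwards [this, self_mem_nhdsWithin] with r hr hr1 t ht htπ z hzr
    have hz : z ∈ Metric.ball (0 : ℂ) 1 := by rw [mem_ball_zero_iff, hzr]; exact hr1
    have hint := hasHKIntegral_of_hasDerivAt ht (hBt z hz)
    have hint' := (hint.congr (g := fun s => w (polar r (s + z.arg))) fun s => by
      rw [← hpolar, ← hzr, polar_norm_arg])
    have hint2 := HasHKIntegral.comp_add_right (f := fun s => w (polar r (s + z.arg)))
      (T := -z.arg) (a := z.arg) (b := t + z.arg) (by simpa using hint')
    have hint3 := hint2.congr (g := fun s => w (polar r s)) fun s => by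
      rw [neg_add_cancel_right]
    have e := (ofReal_abs_hkIntegral_le_alexiewiczNorm hint3 (by linarith)).trans hr.le
    rw [ENNReal.ofReal_le_ofReal_iff hε.le] at e
    simpa [hBdef, polar] using e
  have hzero : ∀ t, 0 < t → t ≤ 2 * Real.pi → ∀ z ∈ Metric.ball (0 : ℂ) 1, (B t z).re = 0 := by
    intro t ht htπ z hz
    refine le_antisymm ?_ ?_
    · refine re_nonpos_of_eventually_re_le (hB t) (fun ε hε => ?_) hz
      filter_upwards [hbound ε hε] with r hr z hz
      exact (le_abs_self _).trans (hr t ht htπ z hz)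
    · have := re_nonpos_of_eventually_re_le (hB t).neg (fun ε hε => ?_) hz
      · simpa using this
      filter_upwards [hbound ε hε] with r hr z hz
      simpa using (neg_le_abs _).trans (hr t ht htπ z hz)
  have hz' := hrot (-1) z hz
  have h1 := hBt _ hz' 1
  have h2 : (fun t => (B t (polar 1 (-1) * z)).re) =ᶠ[𝓝 1] fun _ => 0 := by
    filter_upwards [Ioo_mem_nhds one_pos (by linarith [Real.pi_gt_three] : (1 : ℝ) < 2 * Real.pi)]
      with t ht
    exact hzero t ht.1 ht.2.le _ hz'
  have h3 := h1.unique ((hasDerivAt_const (1 : ℝ) (0 : ℝ)).congr_of_eventuallyEq h2)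
  rw [← mul_assoc, hpolar] at h3
  simpa [polar] using h3

theorem IsDirichletSolution.eqOn {f : ℝ → ℝ} {u v : ℂ → ℝ} (hu : IsDirichletSolution f u)
    (hv : IsDirichletSolution f v) : EqOn u v (Metric.ball 0 1) := by
  intro z hz
  refine sub_eq_zero.1 (eq_zero_of_tendsto_alexiewiczNorm_zero (w := u - v)
    (hu.harmonicOnNhd.sub hv.harmonicOnNhd) ?_ hz)
  have hsum := hu.tendsto_boundary.add hv.tendsto_boundary
  rw [add_zero] at hsum
  refine tendsto_of_tendsto_of_tendsto_of_le_of_le tendsto_const_nhds hsum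
    (fun _ => zero_le) fun r => ?_
  have := alexiewiczNorm_sub_le (fun θ => u (polar r θ) - f θ) (fun θ => v (polar r θ) - f θ)
  simpa using this

end HKPoisson

theorem mainTheorem3 (f : ℝ → ℝ) (hf : f ∈ HKPoisson.HK) :
    (∀ r θ : ℝ, 0 ≤ r → r < 1 →
      HKPoisson.HasHKIntegral (fun φ => f φ * HKPoisson.poissonKernel r (φ - θ))
        (-Real.pi) Real.pi (HKPoisson.poissonIntegral f (HKPoisson.polar r θ))) ∧
    HKPoisson.IsDirichletSolution f (HKPoisson.poissonIntegral f) ∧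
    ∀ u : ℂ → ℝ, HKPoisson.IsDirichletSolution f u →
      Set.EqOn u (HKPoisson.poissonIntegral f) (Metric.ball 0 1) := by
  open HKPoisson Filter in
  obtain ⟨m, G, hGc, hG, hprim⟩ := exists_periodic_primitive hf
  have hint : ∀ z ∈ Metric.ball (0 : ℂ) 1, HasHKIntegral (fun φ => f φ * boundaryKernel z φ)
      (-Real.pi) Real.pi (poissonIntegral f z) := by
    intro z hz
    have h := hasHKIntegral_mul_boundaryKernel hGc hG hprim hz
    convert h using 1
    rw [← h.hkIntegral_eq, poissonIntegral]
    congr 1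
    ext φ
    rw [← boundaryKernel_polar, polar_norm_arg]
  have hval : ∀ z ∈ Metric.ball (0 : ℂ) 1,
      poissonIntegral f z = m + (Complex.I * z * herglotzIntegralDeriv G z).re := fun z hz =>
    (hint z hz).unique (hasHKIntegral_mul_boundaryKernel hGc hG hprim hz)
  have hder := fun z hz => hasDerivAt_herglotzIntegral hGc hG (w := z) hz
  have hharm : InnerProductSpace.HarmonicOnNhd (poissonIntegral f) (Metric.ball 0 1) := by
    intro z hz
    have hd : DifferentiableOn ℂ (herglotzIntegral G) (Metric.ball 0 1) :=
      fun z hz => (hder z hz).differentiableAt.differentiableWithinAt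
    have ha : AnalyticAt ℂ (fun z => (m : ℂ) + Complex.I * z * deriv (herglotzIntegral G) z) z :=
      analyticAt_const.add ((analyticAt_const.mul analyticAt_id).mul
        (hd.analyticAt (Metric.isOpen_ball.mem_nhds hz)).deriv)
    refine (InnerProductSpace.harmonicAt_congr_nhds ?_).1 ha.harmonicAt_re
    filter_upwards [Metric.isOpen_ball.mem_nhds hz] with w hw
    rw [hval w hw, (hder w hw).deriv]
    simp
  have hsol : IsDirichletSolution f (poissonIntegral f) := by
    refine ⟨hharm.contDiffOn, fun z hz => (hharm z hz).2.self_of_nhds, ?_⟩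
    rw [ENNReal.tendsto_nhds_zero]
    intro ε hε
    obtain ⟨c, hc, hcε⟩ : ∃ c : ℝ, 0 < c ∧ ENNReal.ofReal c ≤ ε := by
      obtain ⟨c, hc, hcε⟩ := ENNReal.lt_iff_exists_nnreal_btwn.1 hε
      exact ⟨c, by exact_mod_cast hc, by simpa using hcε.le⟩
    have hpos : ∀ᶠ r in 𝓝[<] (1 : ℝ), 0 ≤ r :=
      nhdsWithin_le_nhds (le_mem_nhds one_pos)
    filter_upwards [eventually_abs_re_herglotzIntegral_sub_le hGc hG (half_pos hc), hpos,
      self_mem_nhdsWithin] with r hr h0 h1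
    refine (alexiewiczNorm_le fun a b hab hba => ?_).trans hcε
    have hu := hasHKIntegral_of_hasDerivAt hab (φ := fun θ => poissonIntegral f (polar r θ))
      (G := fun θ => m * θ + (herglotzIntegral G (polar r θ)).re) fun θ => by
        have hz := polar_mem_ball θ h0 h1
        rw [hval _ hz]
        exact (((hasDerivAt_id θ).const_mul m).add
          (hasDerivAt_re_comp_polar (hder _ hz))).congr_deriv
          (by rw [mul_one])
    refine ⟨_, hu.sub (hprim a b hab hba), ?_⟩
    have e1 := abs_le.1 (hr a)
    have e2 := abs_le.1 (hr b)
    rw [abs_le]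
    constructor <;> linarith
  refine ⟨fun r θ h0 h1 => ?_, hsol, fun u hu => hu.eqOn hsol⟩
  exact (hint _ (polar_mem_ball θ h0 h1)).congr fun φ => by rw [boundaryKernel_polar]
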